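/- Let $\mathbb T$ be the circle group with its Borel $\sigma$-field and normalized Lebesgue (Haar) measure $m$, and for $1\le p\le\infty$ let $L_p=L_p(\mathbb T,m)$ be the space of complex-valued functions. Given a Borel probability measure $\mu$ on $\mathbb T$, let $\mu^k$ denote its $k$-th convolution power, and let $P_\mu$ be the Markov operator $P_\mu f(x)=\int_{\mathbb T} f(xy)\,\mu(dy)$, which is a contraction of $L_p$ for every $1\le p\le\infty$. Let $Ef=\int_{\mathbb T} f\,dm$, regarded as the operator of $L_p$ that sends $f$ to a constant function, and write $\|\cdot\|_p$ for the operator norm on $L_p$. A measure on $\mathbb T$ is called non-singular if it is not singular with respect to $m$. **Theorem.** Let $\mu$ be a Borel probability measure on $\mathbb T$ such that $\mu^k$ is non-singular for some integer $k\ge 1$. Then $\|P_\mu^n-E\|_p\to 0$ as $n\to\infty$ for every $1\le p\le\infty$ (in particular for $p=1$ and $p=\infty$). -/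

import Mathlib

open MeasureTheory Filter Topology
open scoped ENNReal

noncomputable section

namespace CircleWalk

/-- The circle group carries its Borel sigma-algebra. -/
instance instMeasurableSpaceCircle : MeasurableSpace Circle := borel Circle

instance instBorelSpaceCircle : BorelSpace Circle := ⟨rfl⟩

/-- Normalized Lebesgue (Haar) measure on the circle group. -/
def haar : Measure Circle := Measure.haarMeasure (⊤ : TopologicalSpace.PositiveCompacts Circle)

instance : haar.IsHaarMeasure :=
  inferInstanceAs (Measure.haarMeasure (⊤ : TopologicalSpace.PositiveCompacts Circle)).IsHaarMeasure

instance : IsProbabilityMeasure haar :=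
  ⟨Measure.haarMeasure_self (K₀ := (⊤ : TopologicalSpace.PositiveCompacts Circle))⟩

/-- The `k`-th convolution power of `μ`: `k = 0` gives the point mass at `1`, and
`k = 1` gives `μ` itself. -/
def convPower (μ : Measure Circle) : ℕ → Measure Circle
  | 0 => Measure.dirac 1
  | k + 1 => (convPower μ k).mconv μ

/-- A measure on the circle is non-singular if it is not (mutually) singular with respect to
Lebesgue measure. -/
def NonSingular (ν : Measure Circle) : Prop := ¬ Measure.MutuallySingular ν haar

/-- The function `P_μ f (x) = ∫ f(xy) μ(dy)`. -/
def average (μ : Measure Circle) (f : Circle → ℂ) (x : Circle) : ℂ := ∫ y, f (x * y) ∂μ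

theorem measurePreserving_mul (μ : Measure Circle) [IsProbabilityMeasure μ] :
    MeasurePreserving (fun z : Circle × Circle => z.1 * z.2) (haar.prod μ) haar := by
  have h := (measurePreserving_snd (μ := μ) (ν := haar)).comp
    ((measurePreserving_prod_mul μ haar).comp
      (Measure.measurePreserving_swap (μ := haar) (ν := μ)))
  convert h using 1
  ext z : 1
  simp [mul_comm]

theorem average_congr (μ : Measure Circle) [IsProbabilityMeasure μ] {f g : Circle → ℂ}
    (h : f =ᵐ[haar] g) : average μ f =ᵐ[haar] average μ g := by
  have h1 := (measurePreserving_mul μ).quasiMeasurePreserving.ae_eq_comp h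
  filter_upwards [Measure.ae_ae_of_ae_prod h1] with x hx
  exact integral_congr_ae hx

theorem aestronglyMeasurable_mul (μ : Measure Circle) [IsProbabilityMeasure μ] {f : Circle → ℂ}
    (hf : AEStronglyMeasurable f haar) :
    AEStronglyMeasurable (fun z : Circle × Circle => f (z.1 * z.2)) (haar.prod μ) :=
  hf.comp_measurePreserving (measurePreserving_mul μ)

theorem aestronglyMeasurable_average (μ : Measure Circle) [IsProbabilityMeasure μ]
    {f : Circle → ℂ} (hf : AEStronglyMeasurable f haar) :
    AEStronglyMeasurable (average μ f) haar :=
  (aestronglyMeasurable_mul μ hf).integral_prod_right'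

theorem eLpNorm_average_le (μ : Measure Circle) [IsProbabilityMeasure μ] {p : ℝ≥0∞} (hp : 1 ≤ p)
    {f : Circle → ℂ} (hf : AEStronglyMeasurable f haar) :
    eLpNorm (average μ f) p haar ≤ eLpNorm f p haar := by
  have hF := aestronglyMeasurable_mul μ hf
  have key : ∀ᵐ x ∂haar, ‖average μ f x‖ₑ ≤ eLpNorm (fun y => f (x * y)) p μ := by
    filter_upwards [hF.prodMk_left] with x hx
    calc ‖average μ f x‖ₑ ≤ ∫⁻ y, ‖f (x * y)‖ₑ ∂μ := enorm_integral_le_lintegral_enorm _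
      _ = eLpNorm (fun y => f (x * y)) 1 μ := eLpNorm_one_eq_lintegral_enorm.symm
      _ ≤ _ := eLpNorm_le_eLpNorm_of_exponent_le hp hx
  by_cases htop : p = ∞
  · subst htop
    have hb : ∀ᵐ z ∂(haar.prod μ), ‖f (z.1 * z.2)‖ₑ ≤ eLpNorm f ∞ haar := by
      have : ∀ᵐ x ∂haar, ‖f x‖ₑ ≤ eLpNorm f ∞ haar := by
        rw [eLpNorm_exponent_top]
        exact enorm_ae_le_eLpNormEssSup f haar
      exact (measurePreserving_mul μ).quasiMeasurePreserving.ae this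
    rw [eLpNorm_exponent_top (f := average μ f)]
    refine essSup_le_of_ae_le _ ?_
    filter_upwards [key, Measure.ae_ae_of_ae_prod hb] with x hx hy
    refine hx.trans ?_
    rw [eLpNorm_exponent_top (f := fun y => f (x * y))]
    exact essSup_le_of_ae_le _ hy
  · have h0 : p ≠ 0 := (zero_lt_one.trans_le hp).ne'
    have hpos : 0 < p.toReal := ENNReal.toReal_pos h0 htop
    have hpow : ∀ (ν : Measure Circle) (g : Circle → ℂ),
        eLpNorm g p ν ^ p.toReal = ∫⁻ x, ‖g x‖ₑ ^ p.toReal ∂ν := by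
      intro ν g
      rw [eLpNorm_eq_lintegral_rpow_enorm_toReal h0 htop, ← ENNReal.rpow_mul,
        one_div_mul_cancel hpos.ne', ENNReal.rpow_one]
    rw [← ENNReal.rpow_le_rpow_iff hpos, hpow, hpow]
    calc ∫⁻ x, ‖average μ f x‖ₑ ^ p.toReal ∂haar
        ≤ ∫⁻ x, ∫⁻ y, ‖f (x * y)‖ₑ ^ p.toReal ∂μ ∂haar := by
          refine lintegral_mono_ae ?_
          filter_upwards [key] with x hx
          rw [← hpow μ (fun y => f (x * y))]
          exact ENNReal.rpow_le_rpow hx hpos.le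
      _ = ∫⁻ z, ‖f (z.1 * z.2)‖ₑ ^ p.toReal ∂(haar.prod μ) :=
          (lintegral_prod (fun z : Circle × Circle => ‖f (z.1 * z.2)‖ₑ ^ p.toReal)
            (hF.enorm.pow_const _)).symm
      _ = ∫⁻ x, ‖f x‖ₑ ^ p.toReal ∂haar := by
          have h2 : AEMeasurable (fun x => ‖f x‖ₑ ^ p.toReal) haar := hf.enorm.pow_const _
          conv_rhs => rw [← (measurePreserving_mul μ).map_eq]
          rw [lintegral_map' (by rwa [(measurePreserving_mul μ).map_eq])
            (measurePreserving_mul μ).aemeasurable]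

theorem memLp_average (μ : Measure Circle) [IsProbabilityMeasure μ] {p : ℝ≥0∞} (hp : 1 ≤ p)
    {f : Circle → ℂ} (hf : MemLp f p haar) : MemLp (average μ f) p haar :=
  ⟨aestronglyMeasurable_average μ hf.1, (eLpNorm_average_le μ hp hf.1).trans_lt hf.2⟩

theorem ae_integrable_mul (μ : Measure Circle) [IsProbabilityMeasure μ] {f : Circle → ℂ}
    (hf : Integrable f haar) : ∀ᵐ x ∂haar, Integrable (fun y => f (x * y)) μ :=
  ((measurePreserving_mul μ).integrable_comp_of_integrable hf).prod_right_ae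

theorem average_add (μ : Measure Circle) [IsProbabilityMeasure μ] {f g : Circle → ℂ}
    (hf : Integrable f haar) (hg : Integrable g haar) :
    average μ (f + g) =ᵐ[haar] average μ f + average μ g := by
  filter_upwards [ae_integrable_mul μ hf, ae_integrable_mul μ hg] with x h1 h2
  exact integral_add h1 h2

/-- The Markov operator `P_μ f (x) = ∫ f(xy) μ(dy)`, as a bounded linear operator of complex
`L_p` of the circle, for `1 ≤ p ≤ ∞`. -/
def markovOp (μ : Measure Circle) [IsProbabilityMeasure μ] (p : ℝ≥0∞) [hp : Fact (1 ≤ p)] :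
    Lp ℂ p haar →L[ℂ] Lp ℂ p haar :=
  LinearMap.mkContinuous
    { toFun := fun f => (memLp_average μ hp.out (Lp.memLp f)).toLp (average μ f)
      map_add' := fun f g => by
        rw [← MemLp.toLp_add, MemLp.toLp_eq_toLp_iff]
        exact (average_congr μ (Lp.coeFn_add f g)).trans
          (average_add μ ((Lp.memLp f).integrable hp.out) ((Lp.memLp g).integrable hp.out))
      map_smul' := fun c f => by
        rw [RingHom.id_apply, ← MemLp.toLp_const_smul, MemLp.toLp_eq_toLp_iff]
        refine (average_congr μ (Lp.coeFn_smul c f)).trans (Eventually.of_forall fun x => ?_)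
        exact integral_smul c _ } 1
    (fun f => by
      rw [one_mul]
      change ‖(memLp_average μ hp.out (Lp.memLp f)).toLp (average μ f)‖ ≤ ‖f‖
      rw [Lp.norm_toLp, Lp.norm_def]
      exact ENNReal.toReal_mono (Lp.eLpNorm_ne_top f)
        (eLpNorm_average_le μ hp.out (Lp.aestronglyMeasurable f)))

theorem coeFn_markovOp (μ : Measure Circle) [IsProbabilityMeasure μ] (p : ℝ≥0∞)
    [hp : Fact (1 ≤ p)] (f : Lp ℂ p haar) :
    markovOp μ p f =ᵐ[haar] fun x => ∫ y, f (x * y) ∂μ :=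
  (memLp_average μ hp.out (Lp.memLp f)).coeFn_toLp

/-- The integral functional `f ↦ ∫ f dm` on `L_p` of the circle, for `1 ≤ p ≤ ∞`. -/
def integralFunctional (p : ℝ≥0∞) [hp : Fact (1 ≤ p)] : Lp ℂ p haar →L[ℂ] ℂ :=
  LinearMap.mkContinuous
    { toFun := fun f => ∫ x, f x ∂haar
      map_add' := fun f g => by
        rw [integral_congr_ae (Lp.coeFn_add f g)]
        exact integral_add ((Lp.memLp f).integrable hp.out) ((Lp.memLp g).integrable hp.out)
      map_smul' := fun c f => by
        rw [integral_congr_ae (Lp.coeFn_smul c f)]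
        exact integral_smul c _ } 1
    (fun f => by
      rw [one_mul]
      change ‖∫ x, f x ∂haar‖ ≤ ‖f‖
      rw [Lp.norm_def, ← toReal_enorm]
      refine ENNReal.toReal_mono (Lp.eLpNorm_ne_top f) ?_
      refine (enorm_integral_le_lintegral_enorm _).trans ?_
      rw [← eLpNorm_one_eq_lintegral_enorm]
      exact eLpNorm_le_eLpNorm_of_exponent_le hp.out (Lp.aestronglyMeasurable f))

/-- The expectation operator `E` on `L_p` of the circle: `E f` is the constant function with
value `∫ f dm`. -/
def expectationOp (p : ℝ≥0∞) [Fact (1 ≤ p)] : Lp ℂ p haar →L[ℂ] Lp ℂ p haar :=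
  (Lp.constL p haar ℂ).comp (integralFunctional p)

theorem coeFn_expectationOp (p : ℝ≥0∞) [Fact (1 ≤ p)] (f : Lp ℂ p haar) :
    expectationOp p f =ᵐ[haar] fun _ => ∫ x, f x ∂haar :=
  Lp.coeFn_const (p := p) (μ := haar) (∫ x, f x ∂haar)

end CircleWalk

end

noncomputable section

namespace CircleWalk

/-! Suppose first that `ν` itself is non-singular, and put `P = P_ν`, `Q_n = P^n - E`. Since `P` is
a contraction and `P Q_n = Q_{n+1}`, the norms `‖Q_n‖` decrease to a limit `L`. Split `ν` along a
set `N` with `ν N < 1` off which `ν` has a density `g`. This gives `P = S + W_g`, where `‖S‖ ≤ ν N`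
and `W_g f(x) = ∫ f(xy) g(y) m(dy)`. If `‖W_g Q_n‖ → 0`, then `L ≤ ν(N) L`, so `L = 0`.

That convergence is `tendsto_weightedOp_mul`. As `‖W_g‖ ≤ ‖g‖₁`, the good `g` form a closed subspace
of `L₁`, so characters suffice. For `g = z ^ j` with `j ≠ 0`, `W_g P^n` is `W_g` times the `n`-th
power of a Fourier coefficient of `ν`, of modulus less than one by non-singularity. The
approximation takes place in the kernel, in `L₁`, and not in `L_p`, so `p = ∞` needs no separate
treatment.

If only `μ^k` is non-singular, the case above gives convergence along multiples of `k`, and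
monotonicity gives the rest. -/

/-- The weighted average `x ↦ ∫ f(xy) g(y) ρ(dy)`. -/
def weightedAverage (ρ : Measure Circle) (g f : Circle → ℂ) (x : Circle) : ℂ :=
  ∫ y, f (x * y) * g y ∂ρ

/-! ### Convolution operators with an integrable weight -/

section WeightedAverage

variable (ρ : Measure Circle) [IsProbabilityMeasure ρ]

theorem integrable_weighted_prod {f g : Circle → ℂ} (hf : Integrable f haar)
    (hg : Integrable g ρ) :
    Integrable (fun z : Circle × Circle => f (z.1 * z.2) * g z.2) (haar.prod ρ) := by
  have hm : AEStronglyMeasurable (fun z : Circle × Circle => f (z.1 * z.2) * g z.2)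
      (haar.prod ρ) := (aestronglyMeasurable_mul ρ hf.1).mul hg.1.comp_snd
  have h1 : ∀ y, Integrable (fun x => f (x * y) * g y) haar := fun y => by
    have h := hf.comp_mul_right y
    exact h.mul_const _
  have h2 : ∀ y, ∫ x, ‖f (x * y) * g y‖ ∂haar = (∫ x, ‖f x‖ ∂haar) * ‖g y‖ := fun y => by
    simp_rw [norm_mul]
    rw [integral_mul_const, integral_mul_right_eq_self (fun x => ‖f x‖) y]
  have h3 : Integrable (fun y => ∫ x, ‖f (x * y) * g y‖ ∂haar) ρ := by
    rw [funext h2]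
    exact hg.norm.const_mul _
  exact (integrable_prod_iff' hm).2 ⟨Eventually.of_forall h1, h3⟩

theorem ae_integrable_weighted {f g : Circle → ℂ} (hf : Integrable f haar)
    (hg : Integrable g ρ) : ∀ᵐ x ∂haar, Integrable (fun y => f (x * y) * g y) ρ :=
  (integrable_weighted_prod ρ hf hg).prod_right_ae

/-- Even for singular `ρ`, Haar-null changes of `f` are harmless: multiplication pushes `haar.prod
ρ` forward to `haar`. -/
theorem weightedAverage_congr {f f' g g' : Circle → ℂ} (hf : f =ᵐ[haar] f') (hg : g =ᵐ[ρ] g') :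
    weightedAverage ρ g f =ᵐ[haar] weightedAverage ρ g' f' := by
  have h1 := (measurePreserving_mul ρ).quasiMeasurePreserving.ae_eq_comp hf
  filter_upwards [Measure.ae_ae_of_ae_prod h1] with x hx
  refine integral_congr_ae ?_
  filter_upwards [hx, hg] with y h2 h3
  simp only [Function.comp_apply] at h2
  simp only [h2, h3]

theorem aestronglyMeasurable_weightedAverage {f g : Circle → ℂ}
    (hf : AEStronglyMeasurable f haar) (hg : AEStronglyMeasurable g ρ) :
    AEStronglyMeasurable (weightedAverage ρ g f) haar :=
  ((aestronglyMeasurable_mul ρ hf).mul hg.comp_snd).integral_prod_right'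

/-- Normalizing `|g| dρ` to a probability measure reduces this bound to `eLpNorm_average_le`. -/
theorem eLpNorm_weightedAverage_le {p : ℝ≥0∞} (hp : 1 ≤ p) {f g : Circle → ℂ}
    (hf : MemLp f p haar) (hg : Integrable g ρ) :
    eLpNorm (weightedAverage ρ g f) p haar ≤ (∫⁻ y, ‖g y‖ₑ ∂ρ) * eLpNorm f p haar := by
  set c : ℝ≥0∞ := ∫⁻ y, ‖g y‖ₑ ∂ρ
  have hctop : c ≠ ∞ := hg.2.ne
  by_cases hc0 : c = 0
  · have hg0 : g =ᵐ[ρ] 0 := by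
      have h := (lintegral_eq_zero_iff' hg.1.enorm).1 hc0
      filter_upwards [h] with y hy
      simpa using hy
    have h := weightedAverage_congr ρ (EventuallyEq.refl (ae haar) f) hg0
    rw [eLpNorm_congr_ae h]
    have hz : weightedAverage ρ 0 f = 0 := by ext x; simp [weightedAverage]
    simp [hz]
  set σ : Measure Circle := c⁻¹ • ρ.withDensity (fun y => ‖g y‖ₑ) with hσ
  have hσp : IsProbabilityMeasure σ := ⟨by
    rw [hσ, Measure.smul_apply, withDensity_apply _ MeasurableSet.univ, setLIntegral_univ,
      smul_eq_mul, ENNReal.inv_mul_cancel hc0 hctop]⟩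
  have hfi : Integrable f haar := hf.integrable hp
  have key : ∀ᵐ x ∂haar, ‖weightedAverage ρ g f x‖ ≤
      c.toReal * ‖average σ (fun y => (‖f y‖ : ℂ)) x‖ := by
    filter_upwards [ae_integrable_mul σ hfi, (aestronglyMeasurable_mul ρ hfi.1).prodMk_left]
      with x hx hm
    have h1 : ‖weightedAverage ρ g f x‖ₑ ≤ c * ∫⁻ y, ‖f (x * y)‖ₑ ∂σ := by
      refine (enorm_integral_le_lintegral_enorm _).trans_eq ?_
      rw [hσ, lintegral_smul_measure, smul_eq_mul, ← mul_assoc, ENNReal.mul_inv_cancel hc0 hctop,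
        one_mul, lintegral_withDensity_eq_lintegral_mul₀ hg.1.enorm hm.enorm]
      simp [enorm_mul, mul_comm]
    have h2 : ‖average σ (fun y => (‖f y‖ : ℂ)) x‖ = (∫⁻ y, ‖f (x * y)‖ₑ ∂σ).toReal := by
      rw [average, integral_complex_ofReal, Complex.norm_real,
        integral_norm_eq_lintegral_enorm hx.1]
      simp
    rw [h2, ← ENNReal.toReal_mul, ← toReal_enorm]
    exact ENNReal.toReal_mono (ENNReal.mul_ne_top hctop hx.2.ne) h1
  calc eLpNorm (weightedAverage ρ g f) p haar
      ≤ ENNReal.ofReal c.toReal * eLpNorm (average σ (fun y => (‖f y‖ : ℂ))) p haar :=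
        eLpNorm_le_mul_eLpNorm_of_ae_le_mul key p
    _ ≤ c * eLpNorm (fun y => (‖f y‖ : ℂ)) p haar := by
        rw [ENNReal.ofReal_toReal hctop]
        gcongr
        exact eLpNorm_average_le σ hp
          (Complex.continuous_ofReal.comp_aestronglyMeasurable hf.1.norm)
    _ = c * eLpNorm f p haar := by
        congr 1
        exact eLpNorm_congr_norm_ae (Eventually.of_forall fun y => by simp)

theorem memLp_weightedAverage {p : ℝ≥0∞} (hp : 1 ≤ p) {f g : Circle → ℂ}
    (hf : MemLp f p haar) (hg : Integrable g ρ) : MemLp (weightedAverage ρ g f) p haar :=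
  ⟨aestronglyMeasurable_weightedAverage ρ hf.1 hg.1,
    (eLpNorm_weightedAverage_le ρ hp hf hg).trans_lt (ENNReal.mul_lt_top hg.2 hf.2)⟩

variable (p : ℝ≥0∞) [hp : Fact (1 ≤ p)]

/-- The weighted average as a bounded bilinear map `L₁(ρ) × L_p → L_p`. -/
def weightedOp : Lp ℂ 1 ρ →L[ℂ] Lp ℂ p haar →L[ℂ] Lp ℂ p haar :=
  LinearMap.mkContinuous₂
    (LinearMap.mk₂ ℂ
      (fun g f => (memLp_weightedAverage ρ hp.out (Lp.memLp f) (L1.integrable_coeFn g)).toLp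
        (weightedAverage ρ g f))
      (fun g g' f => by
        rw [← MemLp.toLp_add, MemLp.toLp_eq_toLp_iff]
        refine (weightedAverage_congr ρ (EventuallyEq.refl _ f) (Lp.coeFn_add g g')).trans ?_
        have hf := (Lp.memLp f).integrable hp.out
        filter_upwards [ae_integrable_weighted ρ hf (L1.integrable_coeFn g),
          ae_integrable_weighted ρ hf (L1.integrable_coeFn g')] with x h1 h2
        simp only [weightedAverage, Pi.add_apply, mul_add]
        exact integral_add h1 h2)
      (fun c g f => by
        rw [← MemLp.toLp_const_smul, MemLp.toLp_eq_toLp_iff]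
        refine (weightedAverage_congr ρ (EventuallyEq.refl _ f) (Lp.coeFn_smul c g)).trans
          (Eventually.of_forall fun x => ?_)
        simp only [weightedAverage, Pi.smul_apply, mul_smul_comm]
        exact integral_smul c _)
      (fun g f f' => by
        rw [← MemLp.toLp_add, MemLp.toLp_eq_toLp_iff]
        refine (weightedAverage_congr ρ (Lp.coeFn_add f f') (EventuallyEq.refl _ g)).trans ?_
        have hg := L1.integrable_coeFn g
        filter_upwards [ae_integrable_weighted ρ ((Lp.memLp f).integrable hp.out) hg,
          ae_integrable_weighted ρ ((Lp.memLp f').integrable hp.out) hg] with x h1 h2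
        simp only [weightedAverage, Pi.add_apply, add_mul]
        exact integral_add h1 h2)
      (fun c g f => by
        rw [← MemLp.toLp_const_smul, MemLp.toLp_eq_toLp_iff]
        refine (weightedAverage_congr ρ (Lp.coeFn_smul c f) (EventuallyEq.refl _ g)).trans
          (Eventually.of_forall fun x => ?_)
        simp only [weightedAverage, Pi.smul_apply, smul_mul_assoc]
        exact integral_smul c _)) 1
    (fun g f => by
      rw [one_mul]
      change ‖(memLp_weightedAverage ρ hp.out (Lp.memLp f) (L1.integrable_coeFn g)).toLp
        (weightedAverage ρ g f)‖ ≤ ‖g‖ * ‖f‖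
      rw [Lp.norm_toLp, Lp.norm_def, Lp.norm_def, ← ENNReal.toReal_mul]
      refine ENNReal.toReal_mono
        (ENNReal.mul_ne_top (Lp.eLpNorm_ne_top g) (Lp.eLpNorm_ne_top f)) ?_
      rw [eLpNorm_one_eq_lintegral_enorm (f := g)]
      exact eLpNorm_weightedAverage_le ρ hp.out (Lp.memLp f) (L1.integrable_coeFn g))

theorem coeFn_weightedOp (g : Lp ℂ 1 ρ) (f : Lp ℂ p haar) :
    weightedOp ρ p g f =ᵐ[haar] weightedAverage ρ g f :=
  (memLp_weightedAverage ρ hp.out (Lp.memLp f) (L1.integrable_coeFn g)).coeFn_toLp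

theorem norm_weightedOp_apply_le (g : Lp ℂ 1 ρ) : ‖weightedOp ρ p g‖ ≤ ‖g‖ := by
  refine ((weightedOp ρ p).le_opNorm g).trans ?_
  refine mul_le_of_le_one_left (norm_nonneg g) ?_
  exact LinearMap.mkContinuous₂_norm_le _ zero_le_one _

end WeightedAverage

/-! ### Characters and their density -/

/-- The character `z ↦ z ^ j` of the circle. -/
def character (j : ℤ) : C(Circle, ℂ) :=
  ⟨fun z => ((z ^ j : Circle) : ℂ), continuous_subtype_val.comp (continuous_zpow j)⟩

theorem character_apply (j : ℤ) (z : Circle) : character j z = ((z ^ j : Circle) : ℂ) := rfl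

theorem norm_character (j : ℤ) (z : Circle) : ‖character j z‖ = 1 := Circle.norm_coe _

theorem character_mul (j : ℤ) (z w : Circle) :
    character j (z * w) = character j z * character j w := by
  simp [character_apply, mul_zpow]

theorem character_neg_mul_self (j : ℤ) (z : Circle) : character (-j) z * character j z = 1 := by
  rw [character_apply, character_apply, ← Circle.coe_mul, ← zpow_add, neg_add_cancel, zpow_zero,
    Circle.coe_one]

/-- Stone–Weierstrass: the span of the characters is a star subalgebra, and `character 1` already
separates points. -/
theorem span_character_closure_eq_top :
    (Submodule.span ℂ (Set.range character)).topologicalClosure = ⊤ := by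
  let A : StarSubalgebra ℂ C(Circle, ℂ) :=
    { toSubalgebra := Algebra.adjoin ℂ (Set.range character)
      star_mem' := by
        change Algebra.adjoin ℂ (Set.range character) ≤
          star (Algebra.adjoin ℂ (Set.range character))
        refine Algebra.adjoin_le ?_
        rintro - ⟨n, rfl⟩
        refine Algebra.subset_adjoin ⟨-n, ContinuousMap.ext fun z => ?_⟩
        rw [character_apply, zpow_neg, Circle.coe_inv_eq_conj]
        rfl }
  have hA : Subalgebra.toSubmodule A.toSubalgebra = Submodule.span ℂ (Set.range character) := by
    change Subalgebra.toSubmodule (Algebra.adjoin ℂ (Set.range character)) = _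
    refine Algebra.adjoin_eq_span_of_subset (R := ℂ) ?_
    refine Set.Subset.trans ?_ Submodule.subset_span
    intro x hx
    refine Submonoid.closure_induction (fun _ => id) ⟨0, ?_⟩ ?_ hx
    · ext z; simp [character_apply]
    · rintro - - - - ⟨m, rfl⟩ ⟨n, rfl⟩
      refine ⟨m + n, ?_⟩
      ext z
      simp [character_apply, zpow_add]
  have hsep : A.SeparatesPoints := by
    intro x y hxy
    refine ⟨_, ⟨character 1, Algebra.subset_adjoin ⟨1, rfl⟩, rfl⟩, ?_⟩
    simpa [character_apply, Circle.coe_inj] using hxy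
  rw [← hA]
  exact congr_arg (Subalgebra.toSubmodule <| StarSubalgebra.toSubalgebra ·)
    (ContinuousMap.starSubalgebra_topologicalClosure_eq_top_of_separatesPoints A hsep)

/-- The character `z ↦ z ^ j` as an element of `L₁`. -/
def characterL1 (j : ℤ) : Lp ℂ 1 haar := ContinuousMap.toLp 1 haar ℂ (character j)

theorem coeFn_characterL1 (j : ℤ) : characterL1 j =ᵐ[haar] character j :=
  ContinuousMap.coeFn_toLp haar (character j)

theorem span_characterL1_closure_eq_top :
    (Submodule.span ℂ (Set.range characterL1)).topologicalClosure = ⊤ := by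
  have h := (ContinuousMap.toLp_denseRange ℂ haar ℂ
    ENNReal.one_ne_top).topologicalClosure_map_submodule span_character_closure_eq_top
  rw [Submodule.map_span, ← Set.range_comp] at h
  exact h

/-! ### Null sets and Fourier coefficients -/

theorem infinite_circle : Infinite Circle :=
  have : Infinite (Set.Ioc (-Real.pi) Real.pi) :=
    (Set.Ioc_infinite (neg_lt_self Real.pi_pos)).to_subtype
  Circle.argEquiv.infinite_iff.2 this

theorem finite_zpow_eq {j : ℤ} (hj : j ≠ 0) (c : ℂ) : {z : Circle | character j z = c}.Finite := by
  have key : ∀ (n : ℕ) (a : ℂ), 0 < n → {z : Circle | (z : ℂ) ^ n = a}.Finite := by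
    intro n a hn
    refine Set.Finite.preimage (f := ((↑) : Circle → ℂ)) (s := {w : ℂ | w ^ n = a})
      Circle.coe_injective.injOn ?_
    refine (Polynomial.nthRoots n a).toFinset.finite_toSet.subset fun w hw => ?_
    simpa [Polynomial.mem_nthRoots hn] using hw
  -- For negative `j`, inverting `z ^ j = c` gives a polynomial equation of degree `|j|`.
  refine (key j.natAbs (if 0 ≤ j then c else c⁻¹) (Int.natAbs_pos.2 hj)).subset fun z hz => ?_
  simp only [Set.mem_ofPred_eq, character_apply, Circle.coe_zpow] at hz ⊢
  split_ifs with h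
  · rw [← hz, ← zpow_natCast, Int.natAbs_of_nonneg h]
  · rw [← hz, ← zpow_natCast, ← zpow_neg, Int.ofNat_natAbs_of_nonpos (by omega)]

/-- By invariance all points have the same mass, and an infinite set of points of equal positive
mass would have infinite measure. -/
theorem haar_singleton (z : Circle) : haar {z} = 0 := by
  have : Infinite Circle := infinite_circle
  have h : ∀ w : Circle, haar {w} = haar {1} := fun w => by
    rw [← measure_preimage_mul haar w {w}]
    congr 1
    ext x
    simp
  by_contra h0
  have htop : haar (Set.univ : Set Circle) = ∞ :=
    Set.infinite_univ.meas_eq_top ⟨haar {1}, h z ▸ h0, fun w _ => (h w).ge⟩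
  exact measure_ne_top haar Set.univ htop

theorem haar_finite {s : Set Circle} (hs : s.Finite) : haar s = 0 := by
  rw [← Set.biUnion_of_singleton s]
  exact (measure_biUnion_null_iff hs.countable).2 fun z _ => haar_singleton z

/-- Translation by some `u` with `u ^ j ≠ 1` multiplies the integral by `u ^ j` without changing it.
-/
theorem integral_character {j : ℤ} (hj : j ≠ 0) : ∫ z, character j z ∂haar = 0 := by
  have : Infinite Circle := infinite_circle
  obtain ⟨u, hu⟩ := (finite_zpow_eq hj 1).exists_notMem
  have h := integral_mul_left_eq_self (μ := haar) (fun z => character j z) u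
  simp_rw [character_mul] at h
  rw [integral_const_mul] at h
  by_contra h0
  exact hu ((mul_eq_right₀ h0).1 h)

/-- Equality in the triangle inequality would force the character to be `ν`-a.e. constant. Then `ν`
would be carried by a finite, hence Haar-null, set and would be singular. -/
theorem norm_integral_character_lt_one {ν : Measure Circle} [IsProbabilityMeasure ν]
    (hν : NonSingular ν) {j : ℤ} (hj : j ≠ 0) : ‖∫ z, character j z ∂ν‖ < 1 := by
  rcases ae_eq_const_or_norm_integral_lt_of_norm_le_const (μ := ν) (f := character j) (C := 1)
    (Eventually.of_forall fun z => (norm_character j z).le) with h | h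
  · refine absurd ?_ hν
    set c := ⨍ z, character j z ∂ν
    have hf := finite_zpow_eq hj c
    refine ⟨{z | character j z = c}ᶜ, hf.measurableSet.compl, ?_, ?_⟩
    · exact h
    · rw [compl_compl]
      exact haar_finite hf
  · simpa using h

/-- Characters are eigenvectors of the transpose of `P_ν`: swap the integrals and translate the
inner one by `y`. -/
theorem integral_average_mul_character (ν : Measure Circle) [IsProbabilityMeasure ν] (j : ℤ)
    {f : Circle → ℂ} (hf : Integrable f haar) :
    ∫ x, average ν f x * character j x ∂haar =
      (∫ y, character (-j) y ∂ν) * ∫ x, f x * character j x ∂haar := by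
  have hint : Integrable (fun z : Circle × Circle => f (z.1 * z.2) * character j z.1)
      (haar.prod ν) :=
    ((measurePreserving_mul ν).integrable_comp_of_integrable hf).mul_bdd (c := 1)
      (by fun_prop) (Eventually.of_forall fun z => (norm_character j z.1).le)
  calc ∫ x, average ν f x * character j x ∂haar
      = ∫ x, ∫ y, f (x * y) * character j x ∂ν ∂haar := by
        simp_rw [integral_mul_const, average]
    _ = ∫ y, ∫ x, f (x * y) * character j x ∂haar ∂ν := integral_integral_swap hint
    _ = ∫ y, character (-j) y * ∫ x, f x * character j x ∂haar ∂ν := by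
        congr 1 with y
        rw [← integral_mul_right_eq_self (fun x => f x * character j x) y, ← integral_const_mul]
        congr 1 with x
        rw [character_mul]
        linear_combination (-(f (x * y) * character j x)) * character_neg_mul_self j y
    _ = _ := integral_mul_const _ _

theorem weightedAverage_character (j : ℤ) (f : Circle → ℂ) (x : Circle) :
    weightedAverage haar (character j) f x =
      (∫ y, f y * character j y ∂haar) * character (-j) x := by
  rw [weightedAverage, ← integral_mul_left_eq_self (fun y => f y * character j y) x,
    ← integral_mul_const]
  congr 1 with y
  rw [character_mul]
  linear_combination (-(f (x * y) * character j y)) * character_neg_mul_self j x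

/-! ### Decay of `P_ν^n - E` after a convolution -/

section Operators

variable (ν : Measure Circle) [IsProbabilityMeasure ν] (p : ℝ≥0∞) [hp : Fact (1 ≤ p)]

theorem coeFn_weightedOp_character (j : ℤ) (f : Lp ℂ p haar) :
    weightedOp haar p (characterL1 j) f =ᵐ[haar]
      fun x => (∫ y, f y * character j y ∂haar) * character (-j) x := by
  refine (coeFn_weightedOp haar p _ f).trans ((weightedAverage_congr haar (EventuallyEq.refl _ f)
    (coeFn_characterL1 j)).trans (Eventually.of_forall fun x => weightedAverage_character j f x))

theorem weightedOp_character_mul_markovOp (j : ℤ) :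
    weightedOp haar p (characterL1 j) * markovOp ν p =
      (∫ y, character (-j) y ∂ν) • weightedOp haar p (characterL1 j) := by
  refine ContinuousLinearMap.ext fun f => Lp.ext ?_
  have h : ∫ y, (markovOp ν p f) y * character j y ∂haar =
      (∫ y, character (-j) y ∂ν) * ∫ x, f x * character j x ∂haar := by
    rw [← integral_average_mul_character ν j ((Lp.memLp f).integrable hp.out)]
    refine integral_congr_ae ?_
    filter_upwards [coeFn_markovOp ν p f] with x hx
    rw [hx, average]
  rw [smul_apply, mul_apply_eq_comp]
  filter_upwards [coeFn_weightedOp_character p j (markovOp ν p f),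
    coeFn_weightedOp_character p j f,
    Lp.coeFn_smul (∫ y, character (-j) y ∂ν) (weightedOp haar p (characterL1 j) f)] with x h1 h2 h3
  rw [h1, h3, Pi.smul_apply, h2, h, smul_eq_mul, mul_assoc]

theorem weightedOp_character_mul_expectationOp {j : ℤ} (hj : j ≠ 0) :
    weightedOp haar p (characterL1 j) * expectationOp p = 0 := by
  refine ContinuousLinearMap.ext fun f => Lp.ext ?_
  have h : ∫ y, (expectationOp p f) y * character j y ∂haar = 0 := by
    have h' : ∫ y, (expectationOp p f) y * character j y ∂haar =
        ∫ y, (∫ x, f x ∂haar) * character j y ∂haar := by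
      refine integral_congr_ae ?_
      filter_upwards [coeFn_expectationOp p f] with x hx
      rw [hx]
    rw [h', integral_const_mul, integral_character hj, mul_zero]
  rw [mul_apply_eq_comp, zero_apply]
  filter_upwards [coeFn_weightedOp_character p j (expectationOp p f),
    Lp.coeFn_zero ℂ p haar] with x h1 h2
  rw [h1, h2, h, zero_mul, Pi.zero_apply]

theorem weightedOp_character_zero :
    weightedOp haar p (characterL1 0) = expectationOp p := by
  refine ContinuousLinearMap.ext fun f => Lp.ext ?_
  filter_upwards [coeFn_weightedOp_character p 0 f, coeFn_expectationOp p f] with x h1 h2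
  rw [h1, h2]
  simp [character_apply]

theorem expectationOp_mul_self : expectationOp p * expectationOp p = expectationOp p := by
  refine ContinuousLinearMap.ext fun f => Lp.ext ?_
  rw [mul_apply_eq_comp]
  filter_upwards [coeFn_expectationOp p (expectationOp p f), coeFn_expectationOp p f] with x h1 h2
  rw [h1, h2, integral_congr_ae (coeFn_expectationOp p f)]
  simp

theorem markovOp_mul_expectationOp : markovOp ν p * expectationOp p = expectationOp p := by
  refine ContinuousLinearMap.ext fun f => Lp.ext ?_
  rw [mul_apply_eq_comp]
  refine (coeFn_markovOp ν p _).trans ((average_congr ν (coeFn_expectationOp p f)).trans ?_)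
  filter_upwards [coeFn_expectationOp p f] with x h1
  rw [h1]
  simp [average]

theorem norm_markovOp_le_one : ‖markovOp ν p‖ ≤ 1 :=
  LinearMap.mkContinuous_norm_le _ zero_le_one _

theorem markovOp_mul_pow_sub (n : ℕ) :
    markovOp ν p * (markovOp ν p ^ n - expectationOp p) =
      markovOp ν p ^ (n + 1) - expectationOp p := by
  rw [mul_sub, markovOp_mul_expectationOp, pow_succ']

theorem antitone_norm_pow_sub :
    Antitone fun n : ℕ => ‖markovOp ν p ^ n - expectationOp p‖ := by
  refine antitone_nat_of_succ_le fun n => ?_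
  rw [← markovOp_mul_pow_sub]
  exact (norm_mul_le _ _).trans
    (mul_le_of_le_one_left (norm_nonneg _) (norm_markovOp_le_one ν p))

theorem weightedOp_character_mul_pow (j : ℤ) (n : ℕ) :
    weightedOp haar p (characterL1 j) * markovOp ν p ^ n =
      (∫ y, character (-j) y ∂ν) ^ n • weightedOp haar p (characterL1 j) := by
  induction n with
  | zero => simp
  | succ n ih =>
    rw [pow_succ, ← mul_assoc, ih, smul_mul_assoc, weightedOp_character_mul_markovOp, smul_smul,
      pow_succ]

/-- For `j = 0` the operator is `E`, and `E P^n = E = E E`, so every term vanishes. For `j ≠ 0` it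
annihilates `E` and turns `P^n` into a geometric scalar factor. -/
theorem tendsto_weightedOp_character_mul (hν : NonSingular ν) (j : ℤ) :
    Tendsto (fun n : ℕ => weightedOp haar p (characterL1 j) *
      (markovOp ν p ^ n - expectationOp p)) atTop (𝓝 0) := by
  by_cases hj : j = 0
  · subst hj
    have h : ∀ n : ℕ, weightedOp haar p (characterL1 0) *
        (markovOp ν p ^ n - expectationOp p) = 0 := fun n => by
      rw [mul_sub, weightedOp_character_mul_pow, weightedOp_character_zero, expectationOp_mul_self]
      simp [character_apply]
    simp [h]
  · have h := (tendsto_pow_atTop_nhds_zero_of_norm_lt_one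
      (norm_integral_character_lt_one hν (neg_ne_zero.2 hj))).smul_const
      (weightedOp haar p (characterL1 j))
    rw [zero_smul] at h
    refine h.congr fun n => ?_
    rw [mul_sub, weightedOp_character_mul_expectationOp p hj, sub_zero,
      weightedOp_character_mul_pow]

theorem tendsto_weightedOp_mul (hν : NonSingular ν) (g : Lp ℂ 1 haar) :
    Tendsto (fun n : ℕ => weightedOp haar p g *
      (markovOp ν p ^ n - expectationOp p)) atTop (𝓝 0) := by
  set Q : ℕ → Lp ℂ p haar →L[ℂ] Lp ℂ p haar := fun n => markovOp ν p ^ n - expectationOp p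
  -- This uniform bound makes the set `V` of good weights closed; adding `1` keeps `C` positive for
  -- the division below.
  obtain ⟨C, hC0, hC⟩ : ∃ C : ℝ, 0 < C ∧ ∀ n, ‖Q n‖ ≤ C :=
    ⟨‖Q 0‖ + 1, by positivity, fun n =>
      (antitone_norm_pow_sub ν p (Nat.zero_le n)).trans (le_add_of_nonneg_right zero_le_one)⟩
  let V : Submodule ℂ (Lp ℂ 1 haar) :=
    { carrier := {g | Tendsto (fun n => weightedOp haar p g * Q n) atTop (𝓝 0)}
      add_mem' := fun {a b} ha hb => by
        simpa [add_mul] using Tendsto.add ha hb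
      zero_mem' := by simp
      smul_mem' := fun c a ha => by
        simpa using Tendsto.const_smul ha c }
  have hV : IsClosed (V : Set (Lp ℂ 1 haar)) := by
    refine isClosed_of_closure_subset fun a ha => ?_
    change Tendsto (fun n => weightedOp haar p a * Q n) atTop (𝓝 0)
    rw [NormedAddGroup.tendsto_nhds_zero]
    intro ε hε
    obtain ⟨b, hb, hab⟩ := Metric.mem_closure_iff.1 ha (ε / (2 * C)) (by positivity)
    have hb' : Tendsto (fun n => weightedOp haar p b * Q n) atTop (𝓝 0) := hb
    filter_upwards [NormedAddGroup.tendsto_nhds_zero.1 hb' (ε / 2) (by positivity)] with n hn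
    have h1 : weightedOp haar p a * Q n =
        weightedOp haar p (a - b) * Q n + weightedOp haar p b * Q n := by
      rw [map_sub, sub_mul, sub_add_cancel]
    have h2 : ‖weightedOp haar p (a - b) * Q n‖ ≤ ε / 2 := by
      calc ‖weightedOp haar p (a - b) * Q n‖ ≤ ‖weightedOp haar p (a - b)‖ * ‖Q n‖ :=
            norm_mul_le _ _
        _ ≤ ε / (2 * C) * C := by
            refine mul_le_mul ((norm_weightedOp_apply_le haar p _).trans ?_) (hC n)
              (norm_nonneg _) (by positivity)
            rw [← dist_eq_norm]
            exact hab.le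
        _ = ε / 2 := by field_simp
    rw [h1]
    linarith [norm_add_le (weightedOp haar p (a - b) * Q n) (weightedOp haar p b * Q n)]
  have hle : (Submodule.span ℂ (Set.range characterL1)).topologicalClosure ≤ V := by
    refine Submodule.topologicalClosure_minimal _ (Submodule.span_le.2 ?_) hV
    rintro - ⟨j, rfl⟩
    exact tendsto_weightedOp_character_mul ν p hν j
  rw [span_characterL1_closure_eq_top] at hle
  exact hle Submodule.mem_top

end Operators

/-! ### Convolution powers as operator powers -/

instance isProbabilityMeasure_convPower (μ : Measure Circle) [IsProbabilityMeasure μ] (k : ℕ) :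
    IsProbabilityMeasure (convPower μ k) := by
  induction k with
  | zero => exact inferInstanceAs (IsProbabilityMeasure (Measure.dirac (1 : Circle)))
  | succ k ih => exact inferInstanceAs (IsProbabilityMeasure ((convPower μ k).mconv μ))

theorem markovOp_mconv (ν μ : Measure Circle) [IsProbabilityMeasure ν] [IsProbabilityMeasure μ]
    (p : ℝ≥0∞) [hp : Fact (1 ≤ p)] :
    markovOp (ν.mconv μ) p = markovOp ν p * markovOp μ p := by
  refine ContinuousLinearMap.ext fun f => Lp.ext ?_
  rw [mul_apply_eq_comp]
  refine (coeFn_markovOp _ p f).trans (EventuallyEq.symm ?_)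
  refine (coeFn_markovOp ν p _).trans ((average_congr ν (coeFn_markovOp μ p f)).trans ?_)
  filter_upwards [ae_integrable_mul (ν.mconv μ) ((Lp.memLp f).integrable hp.out)] with x hx
  simp only [average, integral_mconv hx, mul_assoc]

theorem markovOp_dirac_one (p : ℝ≥0∞) [Fact (1 ≤ p)] :
    markovOp (Measure.dirac 1) p = 1 := by
  refine ContinuousLinearMap.ext fun f => Lp.ext ?_
  refine (coeFn_markovOp _ p f).trans (Eventually.of_forall fun x => ?_)
  simp

theorem markovOp_convPower (μ : Measure Circle) [IsProbabilityMeasure μ] (p : ℝ≥0∞)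
    [Fact (1 ≤ p)] (k : ℕ) : markovOp (convPower μ k) p = markovOp μ p ^ k := by
  induction k with
  | zero => exact (markovOp_dirac_one p).trans (pow_zero _).symm
  | succ k ih => rw [pow_succ, ← ih]; exact markovOp_mconv _ _ p

/-! ### Lebesgue splitting and the non-singular case -/

/-- A non-singular probability is absolutely continuous off a set that it does not fill. -/
theorem NonSingular.exists_restrict_compl_absolutelyContinuous {ν : Measure Circle}
    [IsProbabilityMeasure ν] (hν : NonSingular ν) :
    ∃ N : Set Circle, MeasurableSet N ∧ ν.real N < 1 ∧ ν.restrict Nᶜ ≪ haar := by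
  -- The singular part lives on the Haar-null set `Mᶜ`, which serves as `N`. Were its `ν`-mass one,
  -- `ν` would vanish on `M` and be singular.
  obtain ⟨M, hM, h1, h2⟩ := Measure.mutuallySingular_singularPart ν haar
  refine ⟨Mᶜ, hM.compl, ?_, ?_⟩
  · refine lt_of_le_of_ne measureReal_le_one fun h => hν ⟨M, hM, ?_, h2⟩
    rw [probReal_compl_eq_one_sub hM] at h
    exact (measureReal_eq_zero_iff).1 (by linarith)
  · rw [compl_compl]
    conv_lhs => rw [ν.haveLebesgueDecomposition_add haar]
    rw [Measure.restrict_add, Measure.restrict_eq_zero.2 h1, zero_add]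
    exact Measure.absolutelyContinuous_of_le Measure.restrict_le_self |>.trans
      (withDensity_absolutelyContinuous _ _)

section Operators

variable (ν : Measure Circle) [IsProbabilityMeasure ν] (p : ℝ≥0∞) [hp : Fact (1 ≤ p)]

theorem coeFn_weightedOp_indicator {N : Set Circle} (hN : MeasurableSet N) (f : Lp ℂ p haar) :
    weightedOp ν p (indicatorConstLp 1 hN (measure_ne_top ν N) (1 : ℂ)) f =ᵐ[haar]
      fun x => ∫ y in N, f (x * y) ∂ν := by
  refine (coeFn_weightedOp ν p _ f).trans ((weightedAverage_congr ν (EventuallyEq.refl _ f)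
    indicatorConstLp_coeFn).trans (Eventually.of_forall fun x => ?_))
  simp only [weightedAverage]
  rw [← integral_indicator hN]
  congr 1 with y
  by_cases hy : y ∈ N <;> simp [hy]

theorem markovOp_eq_add_weightedOp_indicator {N : Set Circle} (hN : MeasurableSet N) :
    markovOp ν p = weightedOp ν p (indicatorConstLp 1 hN (measure_ne_top ν N) (1 : ℂ)) +
      weightedOp ν p (indicatorConstLp 1 hN.compl (measure_ne_top ν Nᶜ) (1 : ℂ)) := by
  refine ContinuousLinearMap.ext fun f => Lp.ext ?_
  rw [add_apply]
  refine (coeFn_markovOp ν p f).trans (EventuallyEq.symm ((Lp.coeFn_add _ _).trans ?_))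
  filter_upwards [coeFn_weightedOp_indicator ν p hN f,
    coeFn_weightedOp_indicator ν p hN.compl f,
    ae_integrable_mul ν ((Lp.memLp f).integrable hp.out)] with x h1 h2 h3
  rw [Pi.add_apply, h1, h2, integral_add_compl hN h3]

/-- The Radon–Nikodym density serves as a weight against `haar`, the form required by
`tendsto_weightedOp_mul`. -/
theorem exists_weightedOp_haar_eq {N : Set Circle} (hN : MeasurableSet N)
    (hac : ν.restrict N ≪ haar) :
    ∃ g : Lp ℂ 1 haar, weightedOp haar p g =
      weightedOp ν p (indicatorConstLp 1 hN (measure_ne_top ν N) (1 : ℂ)) := by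
  have hd : Integrable (fun x => (((ν.restrict N).rnDeriv haar x).toReal : ℂ)) haar :=
    Measure.integrable_toReal_rnDeriv.ofReal
  refine ⟨hd.toL1 _, ContinuousLinearMap.ext fun f => Lp.ext ?_⟩
  refine (coeFn_weightedOp haar p _ f).trans ((weightedAverage_congr haar (EventuallyEq.refl _ f)
    hd.coeFn_toL1).trans (EventuallyEq.trans (Eventually.of_forall fun x => ?_)
      (coeFn_weightedOp_indicator ν p hN f).symm))
  simp only [weightedAverage]
  rw [← integral_rnDeriv_smul hac]
  congr 1 with y
  rw [Complex.real_smul, mul_comm]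

theorem NonSingular.tendsto_norm_pow_sub {ν : Measure Circle} [IsProbabilityMeasure ν]
    (hν : NonSingular ν) :
    Tendsto (fun n : ℕ => ‖markovOp ν p ^ n - expectationOp p‖) atTop (𝓝 0) := by
  obtain ⟨N, hN, hlt, hac⟩ := hν.exists_restrict_compl_absolutelyContinuous
  obtain ⟨g, hg⟩ := exists_weightedOp_haar_eq ν p hN.compl hac
  set S := weightedOp ν p (indicatorConstLp 1 hN (measure_ne_top ν N) (1 : ℂ))
  have hSn : ‖S‖ ≤ ν.real N := by
    refine (norm_weightedOp_apply_le ν p _).trans_eq ?_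
    rw [norm_indicatorConstLp one_ne_zero ENNReal.one_ne_top]
    simp
  have hP : markovOp ν p = S + weightedOp haar p g := by
    rw [hg]
    exact markovOp_eq_add_weightedOp_indicator ν p hN
  have hstep : ∀ n : ℕ, ‖markovOp ν p ^ (n + 1) - expectationOp p‖ ≤
      ν.real N * ‖markovOp ν p ^ n - expectationOp p‖ +
        ‖weightedOp haar p g * (markovOp ν p ^ n - expectationOp p)‖ := fun n => by
    have h : markovOp ν p ^ (n + 1) - expectationOp p =
        S * (markovOp ν p ^ n - expectationOp p) +
          weightedOp haar p g * (markovOp ν p ^ n - expectationOp p) := by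
      rw [← add_mul, ← hP, markovOp_mul_pow_sub]
    rw [h]
    refine (norm_add_le _ _).trans (add_le_add_left ?_ _)
    exact (norm_mul_le _ _).trans (mul_le_mul_of_nonneg_right hSn (norm_nonneg _))
  obtain ⟨L, hL⟩ : ∃ L, Tendsto (fun n : ℕ => ‖markovOp ν p ^ n - expectationOp p‖)
      atTop (𝓝 L) :=
    ⟨_, tendsto_atTop_ciInf (antitone_norm_pow_sub ν p)
      ⟨0, by rintro - ⟨n, rfl⟩; exact norm_nonneg _⟩⟩
  have h0 : 0 ≤ L := ge_of_tendsto' hL fun n => norm_nonneg _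
  -- Limit of `hstep`; with `ν.real N < 1` and `0 ≤ L` it leaves only `L = 0`.
  have hle : L ≤ ν.real N * L + 0 := by
    refine le_of_tendsto_of_tendsto' (hL.comp (tendsto_add_atTop_nat 1))
      ((hL.const_mul (ν.real N)).add ?_) hstep
    simpa using (tendsto_weightedOp_mul ν p hν g).norm
  have hL0 : L = 0 := by nlinarith
  rwa [hL0] at hL

end Operators

end CircleWalk

end

/-- If some convolution power `μ^k`, `k ≥ 1`, of a probability `μ` on the circle is non-singular,
then `‖P_μ^n - E‖_p → 0` in the operator norm of `L_p` for every `1 ≤ p ≤ ∞`. -/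
theorem mainTheorem2 (μ : Measure Circle) [IsProbabilityMeasure μ]
    (hμ : ∃ k : ℕ, 1 ≤ k ∧ CircleWalk.NonSingular (CircleWalk.convPower μ k)) :
    ∀ (p : ℝ≥0∞) [Fact (1 ≤ p)],
      Tendsto (fun n : ℕ => ‖CircleWalk.markovOp μ p ^ n - CircleWalk.expectationOp p‖)
        atTop (𝓝 0) := by
  intro p _
  obtain ⟨k, hk, hns⟩ := hμ
  -- An antitone sequence converges as soon as its subsequence `n ↦ k * n` does; `1 ≤ k` makes these
  -- indices unbounded.
  refine (tendsto_iff_tendsto_subseq_of_antitone (CircleWalk.antitone_norm_pow_sub μ p)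
    (tendsto_id.const_mul_atTop' hk)).2 ?_
  refine (hns.tendsto_norm_pow_sub p).congr fun n => ?_
  rw [CircleWalk.markovOp_convPower, ← pow_mul]
  rfl
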